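/- Let $\Gamma$ be a finite simple connected graph of diameter exactly $5$ on $v$ vertices, and let $k \ge 5$ be an odd integer. Suppose that $\Gamma$ is amply regular with parameters $\left(v, k, 0, \frac{k-1}{2}\right)$; that is, every vertex of $\Gamma$ has exactly $k$ neighbours, any two adjacent vertices have no common neighbour, and any two vertices at distance two have exactly $\frac{k-1}{2}$ common neighbours. Then $\Gamma$ is isomorphic to the $5$-cube, i.e. to the graph whose vertices are the binary words of length $5$, two words being adjacent if and only if they differ in exactly one coordinate. -/

import Mathlib

namespace SimpleGraph

/-- A finite graph is amply regular with parameters `(v, k, ℓ, μ)` if it is `k`-regular on `v`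
vertices, any two adjacent vertices have exactly `ℓ` common neighbours, and any two vertices at
distance two have exactly `μ` common neighbours. -/
structure IsAmplyRegularWith {V : Type*} [Fintype V] (G : SimpleGraph V) [DecidableRel G.Adj]
    (v k ℓ μ : ℕ) : Prop where
  card : Fintype.card V = v
  regular : G.IsRegularOfDegree k
  of_adj : ∀ x y : V, G.Adj x y → Fintype.card (G.commonNeighbors x y) = ℓ
  of_dist_eq_two : ∀ x y : V, G.dist x y = 2 → Fintype.card (G.commonNeighbors x y) = μ

/-- The `n`-cube: the vertices are the binary words of length `n`, two of which are adjacent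
when they differ in exactly one coordinate. -/
def hypercubeGraph (n : ℕ) : SimpleGraph (Fin n → Bool) where
  Adj x y := hammingDist x y = 1
  symm := ⟨fun x y h => by rw [hammingDist_comm]; exact h⟩
  loopless := ⟨fun x h => by simp at h⟩

end SimpleGraph

/-!
Write `k = 2 * μ + 1`, so `μ ≥ 2`, and let `x`, `z` be at distance five. Any two distinct vertices
have at most `μ` common neighbours. From this, a vertex at distance three from another has at
least `μ + 1` neighbours closer to it (`lt_card_toward`). Hence a vertex `p` at distance two from
`x` and three from `z` has exactly `μ` neighbours towards `x`, exactly `μ + 1` towards `z`, and no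
others (`card_toward_mid`). Two of the neighbours of `p` towards `z` then share `μ - 1` neighbours
of `z`, so `p` is the only other common neighbour they have (`eq_of_adj_of_adj`).
It follows that a neighbour of `x` closer to `z` has at least `μ ^ 2` neighbours closer to `z`
(`sq_le_card_toward`). As it has at most `k - 1 = 2 * μ` of them, `μ = 2` and `k = 5`.

All these inequalities are now equalities, and every vertex lies on a geodesic from `x` to `z`
(`dist_add_dist`). Attach to a vertex `w` its coordinate set, the set `G.toward w x` of
neighbours of `x` that are closer to `w`. It has `G.dist x w` elements (`card_toward_base`), it
grows by one element along each edge leading away from `x`, and it determines `w`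
(`toward_base_injective`). This gives an injective homomorphism to the 5-cube, and since both
graphs are 5-regular and the cube is connected, it is an isomorphism
(`nonempty_iso_hypercubeGraph`).
-/

namespace SimpleGraph

/-! ### Neighbours closer to a given vertex -/

lemma Connected.dist_le_dist_add_one {V : Type*} {G : SimpleGraph V}
    (hc : G.Connected) (x : V) {u w : V} (h : G.Adj u w) :
    G.dist x w ≤ G.dist x u + 1 ∧ G.dist x u ≤ G.dist x w + 1 := by
  have h1 := hc.dist_triangle (u := x) (v := u) (w := w)
  have h2 := hc.dist_triangle (u := x) (v := w) (w := u)
  rw [dist_eq_one_iff_adj.mpr h] at h1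
  rw [dist_eq_one_iff_adj.mpr h.symm] at h2
  exact ⟨h1, h2⟩

section AmplyRegular

variable {V : Type*} [Fintype V] {G : SimpleGraph V} [DecidableRel G.Adj]

variable (G) in
/-- The neighbours of `w` that are one step closer to `x` than `w` is. -/
noncomputable def toward (x w : V) : Finset V :=
  {u ∈ G.neighborFinset w | G.dist x u + 1 = G.dist x w}

lemma mem_toward {x w u : V} :
    u ∈ G.toward x w ↔ G.Adj w u ∧ G.dist x u + 1 = G.dist x w := by
  simp [toward]

lemma toward_subset_neighborFinset (x w : V) : G.toward x w ⊆ G.neighborFinset w :=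
  Finset.filter_subset _ _

lemma Connected.toward_nonempty (hc : G.Connected) {x w : V} (h : x ≠ w) :
    (G.toward x w).Nonempty := by
  obtain ⟨p, hp⟩ := hc.exists_walk_length_eq_dist w x
  cases p with
  | nil => exact absurd rfl h
  | cons hadj q =>
    rename_i u
    refine ⟨u, mem_toward.mpr ⟨hadj, ?_⟩⟩
    have h1 := dist_le q
    have h2 := (hc.dist_le_dist_add_one x hadj).2
    rw [Walk.length_cons, dist_comm] at hp
    rw [dist_comm] at h1
    omega

lemma Connected.toward_disjoint (hc : G.Connected) {x z p : V}
    (hxz : G.dist x z = 5) (hp : G.dist x p + G.dist z p = 5) :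
    Disjoint (G.toward x p) (G.toward z p) := by
  rw [Finset.disjoint_left]
  intro u h1 h2
  rw [mem_toward] at h1 h2
  have := hc.dist_triangle (u := x) (v := u) (w := z)
  rw [dist_comm (u := u)] at this
  omega

lemma Connected.toward_subset_toward (hc : G.Connected) {x w u : V} (h : u ∈ G.toward x w) :
    G.toward u x ⊆ G.toward w x := by
  intro a ha
  rw [mem_toward] at h ha ⊢
  refine ⟨ha.1, ?_⟩
  rw [dist_comm (v := a), dist_comm (v := x)] at ha ⊢
  have h1 := hc.dist_le_dist_add_one a h.1
  have h2 := hc.dist_triangle (u := x) (v := a) (w := w)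
  rw [dist_eq_one_iff_adj.mpr ha.1] at h2
  omega

lemma Connected.toward_eq_singleton (hc : G.Connected) {x w : V} (h : G.dist x w = 1) :
    G.toward w x = {w} := by
  ext u
  rw [mem_toward, Finset.mem_singleton, dist_comm (v := x), h]
  constructor
  · rintro ⟨-, h1⟩
    exact (hc.dist_eq_zero_iff.mp (by omega)).symm
  · rintro rfl
    exact ⟨dist_eq_one_iff_adj.mp h, by simp⟩

namespace IsAmplyRegularWith

variable {v k μ : ℕ}

lemma card_neighborFinset (hG : G.IsAmplyRegularWith v k 0 μ) (x : V) :
    (G.neighborFinset x).card = k :=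
  hG.regular x

lemma dist_eq_two (hG : G.IsAmplyRegularWith v k 0 μ) (hc : G.Connected) {x y c : V}
    (hne : x ≠ y) (hx : G.Adj c x) (hy : G.Adj c y) : G.dist x y = 2 := by
  have h1 : G.dist x y ≠ 0 := fun h => hne (hc.dist_eq_zero_iff.mp h)
  have h2 : G.dist x y ≠ 1 := by
    intro h
    have h0 := hG.of_adj x y (dist_eq_one_iff_adj.mp h)
    rw [Fintype.card_eq_zero_iff] at h0
    exact h0.elim ⟨c, hx.symm, hy.symm⟩
  have h3 := (hc.dist_le_dist_add_one x hy).1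
  have h4 := dist_eq_one_iff_adj.mpr hx.symm
  omega

variable [DecidableEq V]

lemma card_inter (hG : G.IsAmplyRegularWith v k 0 μ) {x y : V} (h : G.dist x y = 2) :
    (G.neighborFinset x ∩ G.neighborFinset y).card = μ := by
  rw [← hG.of_dist_eq_two x y h, ← Set.toFinset_card]
  congr 1
  ext u
  simp [mem_commonNeighbors]

lemma card_inter_le (hG : G.IsAmplyRegularWith v k 0 μ) (hc : G.Connected) {x y : V}
    (hne : x ≠ y) : (G.neighborFinset x ∩ G.neighborFinset y).card ≤ μ := by
  rcases (G.neighborFinset x ∩ G.neighborFinset y).eq_empty_or_nonempty with h | ⟨c, h⟩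
  · simp [h]
  · simp only [Finset.mem_inter, mem_neighborFinset] at h
    exact (hG.card_inter (hG.dist_eq_two hc hne h.1.symm h.2.symm)).le

end IsAmplyRegularWith

variable [DecidableEq V]

lemma toward_eq_inter {x w : V} (h : G.dist x w = 2) :
    G.toward x w = G.neighborFinset x ∩ G.neighborFinset w := by
  ext u
  simp only [mem_toward, Finset.mem_inter, mem_neighborFinset, h, ← dist_eq_one_iff_adj (u := x)]
  constructor <;> rintro ⟨h1, h2⟩ <;> refine ⟨?_, ?_⟩ <;> first | assumption | omega

lemma Connected.inter_subset_toward (hc : G.Connected) {x w r : V} (h : G.dist x w = 3)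
    (hr : r ∈ G.toward x w) : G.neighborFinset x ∩ G.neighborFinset r ⊆ G.toward w x := by
  intro u hu
  simp only [Finset.mem_inter, mem_neighborFinset, mem_toward] at hu hr ⊢
  refine ⟨hu.1, ?_⟩
  have h1 := hc.dist_le_dist_add_one w hu.1
  have h2 := hc.dist_le_dist_add_one w hu.2
  have h3 := dist_eq_one_iff_adj.mpr hr.1
  rw [dist_comm] at h
  omega

namespace IsAmplyRegularWith

variable {v k μ : ℕ}

lemma card_toward_of_dist_two (hG : G.IsAmplyRegularWith v k 0 μ) {x w : V}
    (h : G.dist x w = 2) : (G.toward x w).card = μ := by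
  rw [toward_eq_inter h, hG.card_inter h]

lemma card_filter_toward (hG : G.IsAmplyRegularWith v k 0 μ) (hc : G.Connected) {x w r : V}
    (h : G.dist x w = 3) (hr : r ∈ G.toward x w) :
    ((G.toward w x).filter (G.Adj r)).card = μ := by
  rw [← hG.card_inter (x := x) (y := r) (by have := (mem_toward.mp hr).2; omega)]
  congr 1
  ext u
  have h1 : u ∈ G.toward w x → G.Adj x u := fun hu => (mem_toward.mp hu).1
  have h2 : u ∈ _ → u ∈ _ := fun hu => hc.inter_subset_toward h hr hu
  simp only [Finset.mem_inter, mem_neighborFinset, Finset.mem_filter] at *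
  tauto

lemma card_toward_comm (hG : G.IsAmplyRegularWith v k 0 μ) (hc : G.Connected) (hμ : 2 ≤ μ)
    {x w : V} (h : G.dist x w = 3) : (G.toward x w).card = (G.toward w x).card := by
  refine Nat.eq_of_mul_eq_mul_right (show 0 < μ by omega)
    (Finset.card_mul_eq_card_mul G.Adj (fun r hr => hG.card_filter_toward hc h hr)
      fun b hb => ?_)
  rw [dist_comm] at h
  simpa only [Finset.bipartiteBelow, G.adj_comm] using hG.card_filter_toward hc h hb

/-- If `w` is at distance three from `x`, two neighbours of `w` closer to `x` have `μ` common
neighbours with `x` each, and share at most `μ - 1` of these, because `w` is a further common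
neighbour of the two. -/
lemma lt_card_toward (hG : G.IsAmplyRegularWith v k 0 μ) (hc : G.Connected) (hμ : 2 ≤ μ)
    {x w : V} (h : G.dist x w = 3) : μ + 1 ≤ (G.toward x w).card := by
  obtain ⟨r, hr⟩ := hc.toward_nonempty (x := x) (w := w) (by rintro rfl; simp at h)
  have h' : G.dist w x = 3 := by rwa [dist_comm]
  have cr := hG.card_filter_toward hc h hr
  obtain ⟨b, hb⟩ := Finset.card_pos.mp (show 0 < _ by rw [cr]; omega)
  rw [Finset.mem_filter] at hb
  obtain ⟨r', hr', hne⟩ := Finset.exists_mem_ne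
    (show 1 < _ by rw [hG.card_filter_toward hc h' hb.1]; omega) r
  rw [Finset.mem_filter] at hr'
  have cr' := hG.card_filter_toward hc h hr'.1
  have hlt : ((G.toward w x).filter (G.Adj r) ∩ (G.toward w x).filter (G.Adj r')).card < μ := by
    refine lt_of_lt_of_le (Finset.card_lt_card (Finset.ssubset_iff_of_subset ?_ |>.mpr
      ⟨w, ?_, ?_⟩)) (hG.card_inter_le hc hne.symm)
    · intro u
      simp only [Finset.mem_inter, Finset.mem_filter, mem_neighborFinset]
      tauto
    · simp only [Finset.mem_inter, mem_neighborFinset]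
      exact ⟨(mem_toward.mp hr).1.symm, (mem_toward.mp hr'.1).1.symm⟩
    · simp only [Finset.mem_inter, Finset.mem_filter, mem_toward]
      intro hw
      have := dist_eq_one_iff_adj.mpr hw.1.1.1
      omega
  have hun := Finset.card_union_add_card_inter
    ((G.toward w x).filter (G.Adj r)) ((G.toward w x).filter (G.Adj r'))
  have hle := Finset.card_le_card (Finset.union_subset
    (Finset.filter_subset (G.Adj r) (G.toward w x)) (Finset.filter_subset (G.Adj r') _))
  rw [hG.card_toward_comm hc hμ h]
  omega

/-! ### Pairs of vertices at distance five -/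

section DistFive

variable {x z : V}

lemma card_toward_mid (hG : G.IsAmplyRegularWith v (2 * μ + 1) 0 μ) (hc : G.Connected)
    (hμ : 2 ≤ μ) (hxz : G.dist x z = 5) {p : V} (hx : G.dist x p = 2) (hz : G.dist z p = 3) :
    (G.toward z p).card = μ + 1 ∧ G.toward x p ∪ G.toward z p = G.neighborFinset p := by
  have h1 := hG.lt_card_toward hc hμ hz
  have h2 := hG.card_toward_of_dist_two hx
  have h3 := Finset.card_union_of_disjoint (hc.toward_disjoint hxz (p := p) (by omega))
  have hsub := Finset.union_subset (toward_subset_neighborFinset (G := G) x p)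
    (toward_subset_neighborFinset z p)
  have h4 := Finset.card_le_card hsub
  have h5 := hG.card_neighborFinset p
  exact ⟨by omega, Finset.eq_of_subset_of_card_le hsub (by omega)⟩

/-- Two neighbours `r`, `r'` of `p` closer to `z` each have `μ` common neighbours with `z`, inside
a set of size `μ + 1`. So they share `μ - 1` neighbours adjacent to `z`, and only one other. -/
lemma eq_of_adj_of_adj (hG : G.IsAmplyRegularWith v (2 * μ + 1) 0 μ) (hc : G.Connected)
    (hμ : 2 ≤ μ) (hxz : G.dist x z = 5) {p : V} (hx : G.dist x p = 2) (hz : G.dist z p = 3)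
    {r r' q : V} (hr : r ∈ G.toward z p) (hr' : r' ∈ G.toward z p) (hne : r ≠ r')
    (hq : G.Adj q r) (hq' : G.Adj q r') (hqz : ¬ G.Adj z q) : q = p := by
  by_contra hqp
  have c1 := hG.card_filter_toward hc hz hr
  have c2 := hG.card_filter_toward hc hz hr'
  have c3 := (hG.card_toward_mid hc hμ hxz hx hz).1
  rw [hG.card_toward_comm hc hμ hz] at c3
  have hun := Finset.card_union_add_card_inter
    ((G.toward p z).filter (G.Adj r)) ((G.toward p z).filter (G.Adj r'))
  have hle := Finset.card_le_card (Finset.union_subset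
    (Finset.filter_subset (G.Adj r) (G.toward p z)) (Finset.filter_subset (G.Adj r') _))
  have hpz : ¬ G.Adj z p := fun h => by
    have := dist_eq_one_iff_adj.mpr h
    omega
  have hsub : insert q (insert p ((G.toward p z).filter (G.Adj r) ∩
      (G.toward p z).filter (G.Adj r'))) ⊆ G.neighborFinset r ∩ G.neighborFinset r' := by
    intro u
    simp only [Finset.mem_insert, Finset.mem_inter, Finset.mem_filter, mem_neighborFinset]
    rintro (rfl | rfl | h)
    · exact ⟨hq.symm, hq'.symm⟩
    · exact ⟨(mem_toward.mp hr).1.symm, (mem_toward.mp hr').1.symm⟩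
    · exact ⟨h.1.2, h.2.2⟩
  have hcard := (Finset.card_le_card hsub).trans (hG.card_inter_le hc hne)
  rw [Finset.card_insert_of_notMem, Finset.card_insert_of_notMem] at hcard
  · omega
  · simp only [Finset.mem_inter, Finset.mem_filter, mem_toward]
    tauto
  · simp only [Finset.mem_insert, Finset.mem_inter, Finset.mem_filter, mem_toward]
    tauto

/-- A neighbour `a` of `x` closer to `z` has a neighbour `p` closer to `z`. Each of the `μ + 1`
neighbours of `p` closer to `z` shares `μ - 1` neighbours other than `p` with `a`, and these
are distinct: `1 + (μ + 1) * (μ - 1) = μ ^ 2` neighbours of `a` closer to `z`. -/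
lemma sq_le_card_toward (hG : G.IsAmplyRegularWith v (2 * μ + 1) 0 μ) (hc : G.Connected)
    (hμ : 2 ≤ μ) (hxz : G.dist x z = 5) {a : V} (hx : G.dist x a = 1) (hz : G.dist z a = 4) :
    μ ^ 2 ≤ (G.toward z a).card := by
  obtain ⟨p, hp⟩ := hc.toward_nonempty (x := z) (w := a) (by rintro rfl; simp at hz)
  have hp' := mem_toward.mp hp
  have hpz : G.dist z p = 3 := by omega
  have hpx : G.dist x p = 2 := by
    have h1 := hc.dist_le_dist_add_one x hp'.1
    have h2 := hc.dist_triangle (u := x) (v := p) (w := z)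
    rw [dist_comm (u := p)] at h2
    omega
  let S : V → Finset V := fun r => (G.neighborFinset a ∩ G.neighborFinset r).erase p
  have hsub : ∀ r ∈ G.toward z p, G.neighborFinset a ∩ G.neighborFinset r ⊆ G.toward z a := by
    intro r hr u hu
    simp only [Finset.mem_inter, mem_neighborFinset] at hu
    refine mem_toward.mpr ⟨hu.1, ?_⟩
    have h1 := hc.dist_le_dist_add_one z hu.1
    have h2 := hc.dist_le_dist_add_one z hu.2
    have h3 := (mem_toward.mp hr).2
    omega
  have hS : ∀ r ∈ G.toward z p, (S r).card = μ - 1 := by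
    intro r hr
    have hr' := mem_toward.mp hr
    have hpr : p ∈ G.neighborFinset a ∩ G.neighborFinset r := by
      simpa using ⟨hp'.1, hr'.1.symm⟩
    rw [Finset.card_erase_of_mem hpr, hG.card_inter]
    refine hG.dist_eq_two hc ?_ hp'.1.symm hr'.1
    rintro rfl
    omega
  have hdisj : ∀ r ∈ G.toward z p, ∀ r' ∈ G.toward z p, r ≠ r' → Disjoint (S r) (S r') := by
    intro r hr r' hr' hne
    rw [Finset.disjoint_left]
    intro u hu hu'
    simp only [S, Finset.mem_erase, Finset.mem_inter, mem_neighborFinset] at hu hu'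
    refine hu.1 (hG.eq_of_adj_of_adj hc hμ hxz hpx hpz hr hr' hne hu.2.2.symm hu'.2.2.symm ?_)
    intro h
    have h1 := dist_eq_one_iff_adj.mpr h
    have h2 := hc.dist_le_dist_add_one z hu.2.1
    omega
  have hU : insert p ((G.toward z p).biUnion S) ⊆ G.toward z a :=
    Finset.insert_subset hp (Finset.biUnion_subset.mpr fun r hr =>
      (Finset.erase_subset _ _).trans (hsub r hr))
  have hcard := Finset.card_le_card hU
  rw [Finset.card_insert_of_notMem (by simp [S]), Finset.card_biUnion hdisj,
    Finset.sum_congr rfl hS, Finset.sum_const, (hG.card_toward_mid hc hμ hxz hpx hpz).1,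
    smul_eq_mul] at hcard
  obtain ⟨m, rfl⟩ : ∃ m, μ = m + 1 := ⟨μ - 1, by omega⟩
  rw [Nat.add_sub_cancel] at hcard
  nlinarith

lemma toward_subset_erase (hxz : G.dist x z = 5) {a : V} (hz : G.dist z a = 4) :
    G.toward z a ⊆ (G.neighborFinset a).erase x := by
  intro u hu
  rw [mem_toward] at hu
  refine Finset.mem_erase.mpr ⟨?_, by simpa using hu.1⟩
  rintro rfl
  rw [dist_comm] at hxz
  omega

lemma card_erase_neighborFinset (hG : G.IsAmplyRegularWith v k 0 μ) {a : V}
    (hx : G.dist x a = 1) : ((G.neighborFinset a).erase x).card = k - 1 := by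
  rw [Finset.card_erase_of_mem, hG.card_neighborFinset]
  simpa using (dist_eq_one_iff_adj.mp hx).symm

lemma eq_two_of_dist_eq_five (hG : G.IsAmplyRegularWith v (2 * μ + 1) 0 μ) (hc : G.Connected)
    (hμ : 2 ≤ μ) (hxz : G.dist x z = 5) : μ = 2 := by
  obtain ⟨a, ha⟩ := hc.toward_nonempty (x := z) (w := x) (by rintro rfl; simp at hxz)
  rw [mem_toward, dist_comm (v := x), hxz] at ha
  have hx := dist_eq_one_iff_adj.mpr ha.1
  have h1 := hG.sq_le_card_toward hc hμ hxz hx (by omega)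
  have h2 := Finset.card_le_card (toward_subset_erase hxz (a := a) (by omega))
  rw [hG.card_erase_neighborFinset hx] at h2
  nlinarith [show μ ^ 2 ≤ 2 * μ by omega]

end DistFive

/-! ### Valency five: the antipodal layers -/

section Five

variable {x z : V}

lemma toward_eq_erase (hG : G.IsAmplyRegularWith v 5 0 2) (hc : G.Connected)
    (hxz : G.dist x z = 5) {a : V} (hx : G.dist x a = 1) (hz : G.dist z a = 4) :
    G.toward z a = (G.neighborFinset a).erase x := by
  refine Finset.eq_of_subset_of_card_le (toward_subset_erase hxz hz) ?_
  rw [hG.card_erase_neighborFinset hx]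
  exact hG.sq_le_card_toward (μ := 2) hc le_rfl hxz hx hz

lemma dist_eq_four_of_adj (hG : G.IsAmplyRegularWith v 5 0 2) (hc : G.Connected)
    (hxz : G.dist x z = 5) {b : V} (hb : G.Adj x b) : G.dist z b = 4 := by
  obtain ⟨a, ha⟩ := hc.toward_nonempty (x := z) (w := x) (by rintro rfl; simp at hxz)
  rw [mem_toward, dist_comm (v := x), hxz] at ha
  have hxa := dist_eq_one_iff_adj.mpr ha.1
  have hza : G.dist z a = 4 := by omega
  by_cases hab : a = b
  · rwa [← hab]
  -- `a` and `b` have a common neighbour `w` besides `x`.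
  obtain ⟨w, hw, hwx⟩ := Finset.exists_mem_ne (s := G.neighborFinset a ∩ G.neighborFinset b)
    (by rw [hG.card_inter (hG.dist_eq_two hc hab ha.1 hb)]; norm_num) x
  simp only [Finset.mem_inter, mem_neighborFinset] at hw
  have hwa : w ∈ G.toward z a := by
    rw [hG.toward_eq_erase hc hxz hxa hza]
    simpa using ⟨hwx, hw.1⟩
  have hzw : G.dist z w = 3 := by have := (mem_toward.mp hwa).2; omega
  have h1 := hc.dist_le_dist_add_one z hb
  have h2 := hc.dist_le_dist_add_one z hw.2
  rw [dist_comm (v := x)] at h1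
  omega

lemma dist_of_adj_of_dist_le_two (hG : G.IsAmplyRegularWith v 5 0 2) (hc : G.Connected)
    (hxz : G.dist x z = 5) {w u : V} (h : G.Adj w u) (hw : G.dist x w + G.dist z w = 5)
    (hle : G.dist x w ≤ 2) :
    G.dist x u + G.dist z u = 5 ∧ G.dist x u ≠ G.dist x w := by
  have t := hc.dist_triangle (u := x) (v := u) (w := z)
  rw [dist_comm (u := u)] at t
  have t1 := hc.dist_le_dist_add_one x h
  have t2 := hc.dist_le_dist_add_one z h
  obtain h0 | h0 | h0 : G.dist x w = 0 ∨ G.dist x w = 1 ∨ G.dist x w = 2 := by omega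
  · obtain rfl := hc.dist_eq_zero_iff.mp h0
    have h1 := dist_eq_one_iff_adj.mpr h
    have h2 := hG.dist_eq_four_of_adj hc hxz h
    omega
  · by_cases hu : u = x
    · subst hu
      rw [dist_comm] at hxz
      simp only [dist_self] at *
      omega
    · have : u ∈ G.toward z w := by
        rw [hG.toward_eq_erase hc hxz h0 (by omega)]
        simpa using ⟨hu, h⟩
      have := (mem_toward.mp this).2
      omega
  · have : u ∈ G.neighborFinset w := by simpa using h
    rw [← (hG.card_toward_mid (μ := 2) hc le_rfl hxz h0 (by omega)).2, Finset.mem_union,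
      mem_toward, mem_toward] at this
    omega

lemma dist_of_adj (hG : G.IsAmplyRegularWith v 5 0 2) (hc : G.Connected)
    (hxz : G.dist x z = 5) {w u : V} (h : G.Adj w u) (hw : G.dist x w + G.dist z w = 5) :
    G.dist x u + G.dist z u = 5 ∧ G.dist x u ≠ G.dist x w := by
  by_cases hle : G.dist x w ≤ 2
  · exact hG.dist_of_adj_of_dist_le_two hc hxz h hw hle
  · rw [dist_comm] at hxz
    have := hG.dist_of_adj_of_dist_le_two hc hxz h (by omega) (by omega)
    omega

lemma dist_add_dist (hG : G.IsAmplyRegularWith v 5 0 2) (hc : G.Connected)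
    (hxz : G.dist x z = 5) (w : V) : G.dist x w + G.dist z w = 5 := by
  obtain ⟨p⟩ := hc.preconnected w x
  induction p with
  | nil => rw [dist_self, dist_comm, hxz]
  | cons h _ ih => exact (hG.dist_of_adj hc hxz h.symm (ih hxz)).1

lemma card_toward (hG : G.IsAmplyRegularWith v 5 0 2) (hc : G.Connected)
    (hxz : G.dist x z = 5) (w : V) : (G.toward x w).card = G.dist x w := by
  have hw := hG.dist_add_dist hc hxz w
  have hzx : G.dist z x = 5 := by rwa [dist_comm]
  obtain h | h | h | h | h | h : G.dist x w = 0 ∨ G.dist x w = 1 ∨ G.dist x w = 2 ∨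
    G.dist x w = 3 ∨ G.dist x w = 4 ∨ G.dist x w = 5 := by omega
  · rw [h, Finset.card_eq_zero, Finset.eq_empty_iff_forall_notMem]
    intro u hu
    have := (mem_toward.mp hu).2
    omega
  · rw [h, Finset.card_eq_one]
    refine ⟨x, ?_⟩
    ext u
    rw [mem_toward, Finset.mem_singleton, h]
    constructor
    · rintro ⟨-, h1⟩
      exact (hc.dist_eq_zero_iff.mp (by omega)).symm
    · rintro rfl
      exact ⟨(dist_eq_one_iff_adj.mp h).symm, by simp⟩
  · rw [h, hG.card_toward_of_dist_two h]
  · rw [h, (hG.card_toward_mid (μ := 2) hc le_rfl hzx (by omega) h).1]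
  · rw [h, hG.toward_eq_erase hc hzx (by omega) h, hG.card_erase_neighborFinset (by omega)]
  · obtain rfl := hc.dist_eq_zero_iff.mp (show G.dist z w = 0 by omega)
    rw [h, ← hG.card_neighborFinset z]
    congr 1
    refine (toward_subset_neighborFinset _ _).antisymm fun u hu => ?_
    rw [mem_neighborFinset] at hu
    exact mem_toward.mpr ⟨hu, by rw [hG.dist_eq_four_of_adj hc hzx hu, h]⟩

/-! ### Coordinates: a vertex as a set of neighbours of the base point -/

lemma eq_of_toward_eq_of_dist_two (hG : G.IsAmplyRegularWith v 5 0 2) (hc : G.Connected)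
    {w w' : V} (h : G.dist x w = 2) (h' : G.dist x w' = 2)
    (he : G.toward w x = G.toward w' x) : w = w' := by
  by_contra hne
  rw [dist_comm] at h h'
  obtain ⟨a, ha, b, hb, hab⟩ := Finset.one_lt_card.mp
    (show 1 < (G.toward w x).card by rw [hG.card_toward_of_dist_two h]; norm_num)
  have ha' := ha
  have hb' := hb
  rw [he] at ha' hb'
  rw [toward_eq_inter h] at ha hb
  rw [toward_eq_inter h'] at ha' hb'
  simp only [Finset.mem_inter, mem_neighborFinset] at ha hb ha' hb'
  have hsub : {x, w, w'} ⊆ G.neighborFinset a ∩ G.neighborFinset b := by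
    intro u hu
    simp only [Finset.mem_insert, Finset.mem_singleton] at hu
    simp only [Finset.mem_inter, mem_neighborFinset]
    rcases hu with rfl | rfl | rfl
    exacts [⟨ha.2.symm, hb.2.symm⟩, ⟨ha.1.symm, hb.1.symm⟩, ⟨ha'.1.symm, hb'.1.symm⟩]
  have hcard := (Finset.card_le_card hsub).trans (hG.card_inter_le hc hab)
  have hxw : x ≠ w := by rintro rfl; simp at h
  have hxw' : x ≠ w' := by rintro rfl; simp at h'
  rw [Finset.card_eq_three.mpr ⟨x, w, w', hxw, hxw', hne, rfl⟩] at hcard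
  omega

/-- The neighbours of `w` closer to `x` have as coordinate sets all the subsets of the coordinate
set of `w` with one element removed; hence they are determined by that set. As `w` has at least
three such neighbours, it is determined too. -/
lemma eq_of_toward_eq_of_inj (hG : G.IsAmplyRegularWith v 5 0 2) (hc : G.Connected)
    (hxz : G.dist x z = 5) {n : ℕ} (hn : 2 ≤ n)
    (hcn : ∀ u, G.dist x u = n → (G.toward u x).card = n)
    (hinj : ∀ u u', G.dist x u = n → G.dist x u' = n → G.toward u x = G.toward u' x → u = u')
    {w w' : V} (h : G.dist x w = n + 1) (h' : G.dist x w' = n + 1)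
    (hcw : (G.toward w x).card = n + 1)
    (he : G.toward w x = G.toward w' x) : w = w' := by
  have key : ∀ y, G.dist x y = n + 1 → (G.toward y x).card = n + 1 →
      (G.toward x y).image (fun u => G.toward u x) = (G.toward y x).powersetCard n := by
    intro y hy hcy
    refine Finset.eq_of_subset_of_card_le ?_ ?_
    · intro s hs
      obtain ⟨u, hu, rfl⟩ := Finset.mem_image.mp hs
      exact Finset.mem_powersetCard.mpr ⟨hc.toward_subset_toward hu,
        hcn u (by have := (mem_toward.mp hu).2; omega)⟩
    · rw [Finset.card_powersetCard, hcy, Finset.card_image_of_injOn, hG.card_toward hc hxz, hy,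
        Nat.choose_succ_self_right]
      intro u hu u' hu'
      have h1 := (mem_toward.mp (Finset.mem_coe.mp hu)).2
      have h2 := (mem_toward.mp (Finset.mem_coe.mp hu')).2
      exact hinj u u' (by omega) (by omega)
  by_contra hne
  have hsub : G.toward x w ⊆ G.neighborFinset w ∩ G.neighborFinset w' := by
    intro u hu
    have hm : G.toward u x ∈ (G.toward x w').image (fun u => G.toward u x) := by
      rw [key w' h' (he ▸ hcw), ← he, ← key w h hcw]
      exact Finset.mem_image_of_mem _ hu
    obtain ⟨u', hu', heq⟩ := Finset.mem_image.mp hm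
    have h1 := mem_toward.mp hu
    have h2 := mem_toward.mp hu'
    obtain rfl := hinj u' u (by omega) (by omega) heq
    simpa using ⟨h1.1, h2.1⟩
  have hcard := (Finset.card_le_card hsub).trans (hG.card_inter_le hc hne)
  rw [hG.card_toward hc hxz, h] at hcard
  omega

lemma card_toward_base_of_dist_three (hG : G.IsAmplyRegularWith v 5 0 2) (hc : G.Connected)
    (hxz : G.dist x z = 5) {w : V} (h : G.dist x w = 3) : (G.toward w x).card = 3 := by
  rw [← hG.card_toward_comm hc le_rfl h, hG.card_toward hc hxz, h]

lemma card_toward_base_of_dist_two (hG : G.IsAmplyRegularWith v 5 0 2)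
    {w : V} (h : G.dist x w = 2) : (G.toward w x).card = 2 :=
  hG.card_toward_of_dist_two (by rwa [dist_comm])

lemma eq_of_toward_eq_of_dist_three (hG : G.IsAmplyRegularWith v 5 0 2) (hc : G.Connected)
    (hxz : G.dist x z = 5) {w w' : V} (h : G.dist x w = 3) (h' : G.dist x w' = 3)
    (he : G.toward w x = G.toward w' x) : w = w' :=
  hG.eq_of_toward_eq_of_inj hc hxz le_rfl (fun _ hu => hG.card_toward_base_of_dist_two hu)
    (fun _ _ hu hu' => hG.eq_of_toward_eq_of_dist_two hc hu hu') h h'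
    (hG.card_toward_base_of_dist_three hc hxz h) he

/-- At distance four, the upper bound counts the edges from the six vertices halfway between `x`
and `w` in two ways; the lower bound holds because `w` has four neighbours at distance three from
`x`, whose coordinate sets are distinct three-element subsets of that of `w`. -/
lemma card_toward_base_of_dist_four (hG : G.IsAmplyRegularWith v 5 0 2) (hc : G.Connected)
    (hxz : G.dist x z = 5) {w : V} (h : G.dist x w = 4) : (G.toward w x).card = 4 := by
  have h' : G.dist w x = 4 := by rwa [dist_comm]
  have hw4 : (G.toward x w).card = 4 := by rw [hG.card_toward hc hxz, h]
  apply le_antisymm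
  · let M : Finset V := {p | G.dist x p = 2 ∧ G.dist w p = 2}
    have memM : ∀ {p}, p ∈ M ↔ G.dist x p = 2 ∧ G.dist w p = 2 := by simp [M]
    have hM : (G.toward x w).card * 3 = M.card * 2 := by
      refine Finset.card_mul_eq_card_mul G.Adj (fun r hr => ?_) (fun p hp => ?_)
      · have hr' := mem_toward.mp hr
        rw [show 3 = (G.toward x r).card by rw [hG.card_toward hc hxz]; omega]
        congr 1
        ext p
        simp only [Finset.bipartiteAbove, Finset.mem_filter, memM, mem_toward]
        constructor
        · rintro ⟨h1, h2⟩
          exact ⟨h2, by omega⟩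
        · rintro ⟨h1, h2⟩
          have h3 := hc.dist_le_dist_add_one w h1
          rw [dist_eq_one_iff_adj.mpr hr'.1] at h3
          have h4 := hc.dist_triangle (u := x) (v := p) (w := w)
          rw [dist_comm (u := p)] at h4
          exact ⟨⟨by omega, by omega⟩, h1⟩
      · rw [memM] at hp
        rw [← hG.card_inter hp.2]
        congr 1
        ext r
        simp only [Finset.bipartiteBelow, Finset.mem_filter, mem_toward, Finset.mem_inter,
          mem_neighborFinset]
        constructor
        · rintro ⟨h1, h2⟩
          exact ⟨h1.1, h2.symm⟩
        · rintro ⟨h1, h2⟩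
          have h3 := hc.dist_le_dist_add_one x h1
          have h4 := hc.dist_le_dist_add_one x h2
          exact ⟨⟨h1, by omega⟩, h2.symm⟩
    have hM' : (G.toward w x).card * 3 ≤ M.card * 2 := by
      refine Finset.card_mul_le_card_mul G.Adj (fun a ha => ?_) (fun p hp => ?_)
      · have ha' := mem_toward.mp ha
        refine (hG.lt_card_toward hc le_rfl (show G.dist w a = 3 by omega)).trans
          (Finset.card_le_card fun p hp => ?_)
        rw [mem_toward] at hp
        simp only [Finset.bipartiteAbove, Finset.mem_filter, memM]
        have h3 := hc.dist_le_dist_add_one x hp.1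
        rw [dist_eq_one_iff_adj.mpr ha'.1] at h3
        have h4 := hc.dist_triangle (u := x) (v := p) (w := w)
        rw [dist_comm (u := p)] at h4
        exact ⟨⟨by omega, by omega⟩, hp.1⟩
      · rw [memM] at hp
        rw [← hG.card_inter hp.1]
        refine Finset.card_le_card fun a ha => ?_
        simp only [Finset.bipartiteBelow, Finset.mem_filter, mem_toward] at ha
        simpa using ⟨ha.1.1, ha.2.symm⟩
    omega
  · by_contra! hlt
    have hsub : (G.toward x w).image (fun u => G.toward u x) ⊆ (G.toward w x).powersetCard 3 := by
      intro s hs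
      obtain ⟨u, hu, rfl⟩ := Finset.mem_image.mp hs
      exact Finset.mem_powersetCard.mpr ⟨hc.toward_subset_toward hu,
        hG.card_toward_base_of_dist_three hc hxz (by have := (mem_toward.mp hu).2; omega)⟩
    have hcard := Finset.card_le_card hsub
    rw [Finset.card_powersetCard, Finset.card_image_of_injOn, hw4] at hcard
    · have := hcard.trans (Nat.choose_le_choose 3 (show (G.toward w x).card ≤ 3 by omega))
      norm_num at this
    · intro u hu u' hu'
      have h1 := (mem_toward.mp (Finset.mem_coe.mp hu)).2
      have h2 := (mem_toward.mp (Finset.mem_coe.mp hu')).2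
      exact hG.eq_of_toward_eq_of_dist_three hc hxz (by omega) (by omega)

lemma card_toward_base (hG : G.IsAmplyRegularWith v 5 0 2) (hc : G.Connected)
    (hxz : G.dist x z = 5) (w : V) : (G.toward w x).card = G.dist x w := by
  have hw := hG.dist_add_dist hc hxz w
  obtain h | h | h | h | h | h : G.dist x w = 0 ∨ G.dist x w = 1 ∨ G.dist x w = 2 ∨
    G.dist x w = 3 ∨ G.dist x w = 4 ∨ G.dist x w = 5 := by omega
  · rw [h, Finset.card_eq_zero, Finset.eq_empty_iff_forall_notMem]
    intro u hu
    have := (mem_toward.mp hu).2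
    rw [dist_comm (v := x)] at this
    omega
  · rw [hc.toward_eq_singleton h, Finset.card_singleton, h]
  · rw [hG.card_toward_base_of_dist_two h, h]
  · rw [hG.card_toward_base_of_dist_three hc hxz h, h]
  · rw [hG.card_toward_base_of_dist_four hc hxz h, h]
  · obtain rfl := hc.dist_eq_zero_iff.mp (show G.dist z w = 0 by omega)
    rw [hG.card_toward hc (by rwa [dist_comm]), dist_comm]

lemma toward_base_injective (hG : G.IsAmplyRegularWith v 5 0 2) (hc : G.Connected)
    (hxz : G.dist x z = 5) : Function.Injective (fun w => G.toward w x) := by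
  intro w w' (he : G.toward w x = G.toward w' x)
  have hd : G.dist x w = G.dist x w' := by
    rw [← hG.card_toward_base hc hxz, ← hG.card_toward_base hc hxz, he]
  have hw := hG.dist_add_dist hc hxz w
  have hw' := hG.dist_add_dist hc hxz w'
  obtain h | h | h | h | h | h : G.dist x w = 0 ∨ G.dist x w = 1 ∨ G.dist x w = 2 ∨
    G.dist x w = 3 ∨ G.dist x w = 4 ∨ G.dist x w = 5 := by omega
  · exact (hc.dist_eq_zero_iff.mp h).symm.trans (hc.dist_eq_zero_iff.mp (hd ▸ h))
  · rw [hc.toward_eq_singleton h, hc.toward_eq_singleton (hd ▸ h)] at he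
    exact Finset.singleton_injective he
  · exact hG.eq_of_toward_eq_of_dist_two hc h (hd ▸ h) he
  · exact hG.eq_of_toward_eq_of_dist_three hc hxz h (hd ▸ h) he
  · exact hG.eq_of_toward_eq_of_inj hc hxz (by norm_num)
      (fun _ hu => hG.card_toward_base_of_dist_three hc hxz hu)
      (fun _ _ hu hu' => hG.eq_of_toward_eq_of_dist_three hc hxz hu hu') h (hd ▸ h)
      (hG.card_toward_base_of_dist_four hc hxz h) he
  · exact (hc.dist_eq_zero_iff.mp (show G.dist z w = 0 by omega)).symm.trans
      (hc.dist_eq_zero_iff.mp (show G.dist z w' = 0 by omega))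

end Five

end IsAmplyRegularWith

end AmplyRegular

/-! ### The isomorphism with the cube -/

lemma hypercubeGraph_adj_iff {n : ℕ} {x y : Fin n → Bool} :
    (hypercubeGraph n).Adj x y ↔ ∃ i, y = Function.update x i (!x i) := by
  change hammingDist x y = 1 ↔ _
  rw [hammingDist, Finset.card_eq_one]
  refine exists_congr fun i => ⟨fun h => ?_, ?_⟩
  · funext j
    have hj : x j ≠ y j ↔ j = i := by simpa using Finset.ext_iff.mp h j
    by_cases hji : j = i
    · subst hji
      simpa [eq_comm, Bool.eq_not] using hj
    · simpa [hji, eq_comm] using hj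
  · rintro rfl
    ext j
    by_cases hji : j = i
    · subst hji
      simp
    · simp [hji]

/-- The cube is connected, in the form needed: a set of words containing `x` and closed under
adjacency is everything. -/
lemma hypercubeGraph_induction {n : ℕ} {P : (Fin n → Bool) → Prop} (x : Fin n → Bool) (hx : P x)
    (hP : ∀ y y', (hypercubeGraph n).Adj y y' → P y → P y') (y : Fin n → Bool) : P y := by
  induction hd : hammingDist x y generalizing y with
  | zero => rwa [← hammingDist_eq_zero.mp hd]
  | succ d ih =>
    have hpos : (Finset.univ.filter fun i => x i ≠ y i).Nonempty := by
      rw [← Finset.card_pos]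
      change 0 < hammingDist x y
      omega
    obtain ⟨i, hi⟩ := hpos
    refine hP (Function.update y i (!y i)) y
      (Adj.symm (hypercubeGraph_adj_iff.mpr ⟨i, rfl⟩)) (ih _ ?_)
    have he : (Finset.univ.filter fun j => x j ≠ Function.update y i (!y i) j)
        = (Finset.univ.filter fun j => x j ≠ y j).erase i := by
      ext j
      by_cases hji : j = i
      · subst hji
        simpa [Bool.eq_not] using hi
      · simp [hji]
    rw [hammingDist, he, Finset.card_erase_of_mem hi]
    change hammingDist x y - 1 = d
    omega

/-- An injective homomorphism from an `n`-regular graph to the `n`-cube maps neighbourhoods onto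
neighbourhoods, so it reflects adjacency, and it is onto because the cube is connected. -/
lemma nonempty_iso_hypercubeGraph {V : Type*} [Fintype V] [Nonempty V] {G : SimpleGraph V}
    [DecidableRel G.Adj] {n : ℕ} (hreg : G.IsRegularOfDegree n) (f : V → Fin n → Bool)
    (hinj : Function.Injective f) (hadj : ∀ u w, G.Adj u w → (hypercubeGraph n).Adj (f u) (f w)) :
    Nonempty (G ≃g hypercubeGraph n) := by
  have lift : ∀ w y, (hypercubeGraph n).Adj (f w) y → ∃ u, G.Adj w u ∧ f u = y := by
    intro w y hy
    have hsub : (G.neighborFinset w).image f ⊆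
        Finset.univ.image fun i => Function.update (f w) i (!f w i) := by
      intro t ht
      obtain ⟨u, hu, rfl⟩ := Finset.mem_image.mp ht
      obtain ⟨i, hi⟩ := hypercubeGraph_adj_iff.mp (hadj w u ((mem_neighborFinset _ _ _).mp hu))
      exact Finset.mem_image.mpr ⟨i, Finset.mem_univ _, hi.symm⟩
    have heq := Finset.eq_of_subset_of_card_le hsub (by
      rw [Finset.card_image_of_injective _ hinj, card_neighborFinset_eq_degree, hreg w]
      exact Finset.card_image_le.trans (by simp))
    obtain ⟨i, rfl⟩ := hypercubeGraph_adj_iff.mp hy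
    have hm := heq ▸ Finset.mem_image_of_mem _ (Finset.mem_univ i)
    obtain ⟨u, hu, h⟩ := Finset.mem_image.mp hm
    exact ⟨u, (mem_neighborFinset _ _ _).mp hu, h⟩
  have hsurj : Function.Surjective f := by
    obtain ⟨w⟩ := ‹Nonempty V›
    refine hypercubeGraph_induction (P := fun y => ∃ u, f u = y) (f w) ⟨w, rfl⟩ ?_
    rintro y y' h ⟨u, rfl⟩
    obtain ⟨u', -, h'⟩ := lift u y' h
    exact ⟨u', h'⟩
  refine ⟨⟨Equiv.ofBijective f ⟨hinj, hsurj⟩, ?_⟩⟩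
  intro u w
  refine ⟨fun h => ?_, hadj u w⟩
  obtain ⟨w', hw', he⟩ := lift u _ h
  exact hinj he ▸ hw'

/-- The isomorphism sends `w` to the indicator of the set of neighbours of `x` that are closer to
`w` than `x` is. -/
lemma IsAmplyRegularWith.nonempty_iso {V : Type*} [Fintype V] [DecidableEq V]
    {G : SimpleGraph V} [DecidableRel G.Adj] {v : ℕ} (hG : G.IsAmplyRegularWith v 5 0 2)
    (hc : G.Connected) {x z : V} (hxz : G.dist x z = 5) :
    Nonempty (G ≃g hypercubeGraph 5) := by
  have : Nonempty V := ⟨x⟩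
  let e : Fin 5 ≃ G.neighborFinset x :=
    (Finset.equivFinOfCardEq (hG.card_neighborFinset x)).symm
  let f : V → Fin 5 → Bool := fun w i => decide ((e i : V) ∈ G.toward w x)
  refine nonempty_iso_hypercubeGraph hG.regular f (fun w w' he => ?_) ?_
  · refine hG.toward_base_injective hc hxz (Finset.ext fun a => ?_)
    by_cases ha : a ∈ G.neighborFinset x
    · simpa [f] using congrFun he (e.symm ⟨a, ha⟩)
    · exact iff_of_false (fun h => ha (toward_subset_neighborFinset _ _ h))
        (fun h => ha (toward_subset_neighborFinset _ _ h))
  · have main : ∀ u w, u ∈ G.toward x w → (hypercubeGraph 5).Adj (f u) (f w) := by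
      intro u w hu
      have hsub := hc.toward_subset_toward hu
      have hcard : (G.toward w x \ G.toward u x).card = 1 := by
        have := (mem_toward.mp hu).2
        rw [Finset.card_sdiff_of_subset hsub, hG.card_toward_base hc hxz,
          hG.card_toward_base hc hxz]
        omega
      obtain ⟨a, ha⟩ := Finset.card_eq_one.mp hcard
      have mem : ∀ b, b ∈ G.toward w x ∧ b ∉ G.toward u x ↔ b = a := by
        intro b
        rw [← Finset.mem_sdiff, ha, Finset.mem_singleton]
      have hax : a ∈ G.neighborFinset x :=
        toward_subset_neighborFinset _ _ ((mem a).mpr rfl).1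
      change hammingDist (f u) (f w) = 1
      rw [hammingDist, Finset.card_eq_one]
      refine ⟨e.symm ⟨a, hax⟩, ?_⟩
      ext i
      have h1 : (e i : V) = a ↔ i = e.symm ⟨a, hax⟩ := by
        rw [Equiv.eq_symm_apply, Subtype.ext_iff]
      have h2 := @hsub (e i)
      have h3 := mem (e i)
      simp only [Finset.mem_filter, Finset.mem_univ, true_and, Finset.mem_singleton, ← h1, ← h3, f,
        ne_eq, decide_eq_decide]
      tauto
    intro u w h
    have h1 := hc.dist_le_dist_add_one x h
    have h2 := (hG.dist_of_adj hc hxz h (hG.dist_add_dist hc hxz u)).2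
    obtain h3 | h3 : G.dist x u + 1 = G.dist x w ∨ G.dist x w + 1 = G.dist x u := by omega
    · exact main u w (mem_toward.mpr ⟨h.symm, h3⟩)
    · exact Adj.symm (main w u (mem_toward.mpr ⟨h, h3⟩))

end SimpleGraph

theorem theorem4p6 {V : Type*} [Fintype V] (G : SimpleGraph V) [DecidableRel G.Adj]
    (v k : ℕ) (hk : 5 ≤ k) (hodd : Odd k)
    (hG : G.IsAmplyRegularWith v k 0 ((k - 1) / 2))
    (hconn : G.Connected) (hdiam : G.diam = 5) :
    Nonempty (G ≃g SimpleGraph.hypercubeGraph 5) := by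
  classical
  obtain ⟨m, rfl⟩ := hodd
  rw [show (2 * m + 1 - 1) / 2 = m by omega] at hG
  have : Nonempty V := hconn.nonempty
  obtain ⟨x, z, hxz⟩ := G.exists_dist_eq_diam
  rw [hdiam] at hxz
  obtain rfl := hG.eq_two_of_dist_eq_five hconn (by omega) hxz
  exact hG.nonempty_iso hconn hxz
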